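/- Call a monic real polynomial $P$ of degree $n$ *realizable* if it is the characteristic polynomial of an entrywise nonnegative real $n\times n$ matrix, and *irreducibly realizable* if it is the characteristic polynomial of an irreducible entrywise nonnegative real $n\times n$ matrix (equivalently, of the adjacency matrix of a strongly connected digraph on $n$ vertices with positive weights). Let $p\ge 3$, let $k_p,k_{p+1},\dots,k_{2p}\in\mathbb{R}$, and let $$P(x)=x^{2p}+k_p x^{p}+k_{p+1}x^{p-1}+\dots+k_{2p-1}x+k_{2p}\neq x^{2p}.$$ (i) Unless $k_p<0$, $k_{p+1}=\dots=k_{2p-1}=0$ and $k_{2p}=\frac{k_p^2}{4}$, the polynomial $P$ is realizable if and only if it is irreducibly realizable. (ii) If $k_p<0$, $k_{p+1}=\dots=k_{2p-1}=0$ and $k_{2p}=\frac{k_p^2}{4}$, then $P(x)=\left(x^p+\frac{k_p}{2}\right)^2$, and $P$ is realizable but not irreducibly realizable. -/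

import Mathlib

open Polynomial

/-- `P` is realizable: it is the characteristic polynomial of an entrywise nonnegative real
`n × n` matrix. -/
def IsRealizable (n : ℕ) (P : ℝ[X]) : Prop :=
  ∃ A : Matrix (Fin n) (Fin n) ℝ, (∀ i j, 0 ≤ A i j) ∧ A.charpoly = P

/-- `P` is irreducibly realizable: it is the characteristic polynomial of an irreducible
entrywise nonnegative real `n × n` matrix. Here `Matrix.IsIrreducible` includes entrywise
nonnegativity and says that the digraph of positive entries is strongly connected. -/
def IsIrreduciblyRealizable (n : ℕ) (P : ℝ[X]) : Prop :=
  ∃ A : Matrix (Fin n) (Fin n) ℝ, A.IsIrreducible ∧ A.charpoly = P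

/-- The polynomial `x^(2p) + k_p x^p + k_(p+1) x^(p-1) + ⋯ + k_(2p-1) x + k_(2p)`; only the
values `k i` with `p ≤ i ≤ 2p` matter. -/
noncomputable def evenPoly (p : ℕ) (k : ℕ → ℝ) : ℝ[X] :=
  X ^ (2 * p) + ∑ i ∈ Finset.Icc p (2 * p), C (k i) * X ^ (2 * p - i)

/-- The exceptional coefficients: `k_p < 0`, `k_(p+1) = ⋯ = k_(2p-1) = 0` and
`k_(2p) = k_p² / 4`. -/
def IsExceptional (p : ℕ) (k : ℕ → ℝ) : Prop :=
  k p < 0 ∧ (∀ i, p < i → i < 2 * p → k i = 0) ∧ k (2 * p) = k p ^ 2 / 4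

/-!
Newton's identities express the traces of the powers of `A` through the coefficients of its
characteristic polynomial. If the latter is `evenPoly p k`, then `tr (A ^ m) = -m * k m` for
`p ≤ m < 2 * p` and `tr (A ^ (2 * p)) = p * k p ^ 2 - 2 * p * k (2 * p)`. When `A` is nonnegative,
the first traces give `k m ≤ 0`, and since `tr (A ^ (2 * p))` dominates the sum of the squares of
the diagonal entries of `A ^ p`, the nonnegativity of their variance gives
`k (2 * p) ≤ k p ^ 2 / 4`.

Conversely, these inequalities are realized by a companion matrix with one additional edge. The
path `0 → 1 → ⋯ → N` with edges back to `0` has Horner's scheme as an eigenvector, and an edge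
`N → m` subtracts a multiple of the `m`-th Horner polynomial. If `k p < 0`, this edge is chosen to
create a second `p`-cycle of the same weight `-k p / 2`, disjoint from the one through `0`; the
remaining coefficients are nonpositive, and if one of them is negative it supplies the back edge
that makes the digraph strongly connected. If `k p = 0`, some coefficient `k l < 0` is instead
shared between two overlapping `l`-cycles.

In the exceptional case the variance vanishes, so `A ^ p + k p / 2` is a nonnegative matrix whose
square is zero by the Cayley–Hamilton theorem. A nonnegative matrix of square zero that commutes
with an irreducible one is zero, hence `A ^ p` is a nonzero scalar matrix. But then every row of
`A ^ r`, `r < p`, has only one positive entry, so that at most `p` of the `2 * p` vertices can be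
reached from a given one.
-/

section NewtonIdentities

open Matrix

variable {n R : Type*} [Fintype n] [DecidableEq n] [CommRing R]

theorem derivative_det_eq_trace_adjugate_mul (M : Matrix n n R[X]) :
    derivative M.det = (M.adjugate * M.map derivative).trace := by
  have hcol (j : n) : (M.adjugate * M.map derivative) j j =
      ∑ σ : Equiv.Perm n, Equiv.Perm.sign σ •
        ((∏ i ∈ Finset.univ.erase j, M (σ i) i) * derivative (M (σ j) j)) := by
    have hcramer : (M.adjugate * M.map derivative) j j =
        (M.updateCol j fun i => derivative (M i j)).det := by
      rw [← cramer_apply, cramer_eq_adjugate_mulVec]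
      rfl
    rw [hcramer, det_apply]
    refine Finset.sum_congr rfl fun σ _ => ?_
    rw [← Finset.prod_erase_mul _ _ (Finset.mem_univ j), updateCol_self]
    congr 2
    exact Finset.prod_congr rfl fun i hi => updateCol_ne (Finset.ne_of_mem_erase hi)
  simp only [trace, diag_apply, hcol]
  rw [Finset.sum_comm, det_apply, derivative_sum]
  refine Finset.sum_congr rfl fun σ _ => ?_
  rw [derivative_smul, derivative_prod_finset, Finset.smul_sum]

theorem derivative_charpoly_eq_trace_adjugate (A : Matrix n n R) :
    derivative A.charpoly = A.charmatrix.adjugate.trace := by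
  have hmap : A.charmatrix.map derivative = 1 := by
    ext1 i j
    by_cases hij : i = j <;> simp [hij, one_apply]
  rw [charpoly, derivative_det_eq_trace_adjugate_mul, hmap, mul_one]

theorem natDegree_adjugate_charmatrix_lt (A : Matrix n n R) (i j : n) :
    (A.charmatrix.adjugate i j).natDegree < Fintype.card n := by
  set M := A.charmatrix.updateRow j (Pi.single i 1) with hM
  have hrow (l : n) : (M j l).natDegree = 0 := by
    rw [hM, updateRow_self, Pi.single_apply]
    split_ifs <;> simp
  have hentry (k l : n) : (M k l).natDegree ≤ 1 := by
    rcases eq_or_ne k j with rfl | hkj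
    · simp [hrow]
    · rw [hM, updateRow_ne hkj]
      refine (charmatrix_apply_natDegree_le k l).trans ?_
      split_ifs <;> simp
  have hprod (σ : Equiv.Perm n) : (∏ l, M (σ l) l).natDegree < Fintype.card n := by
    refine (natDegree_prod_le _ _).trans_lt ?_
    rw [← Finset.card_univ, Finset.card_eq_sum_ones]
    refine Finset.sum_lt_sum (fun l _ => hentry _ l) ⟨σ.symm j, Finset.mem_univ _, ?_⟩
    rw [σ.apply_symm_apply, hrow]
    exact one_pos
  have hcard : 0 < Fintype.card n := Fintype.card_pos_iff.2 ⟨i⟩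
  rw [adjugate_apply, det_apply, ← Nat.le_sub_one_iff_lt hcard]
  exact natDegree_sum_le_of_forall_le _ _ fun σ _ =>
    (natDegree_smul_le _ _).trans ((Nat.le_sub_one_iff_lt hcard).2 (hprod σ))

theorem charmatrix_mul_geom_sum (A : Matrix n n R) (m : ℕ) :
    A.charmatrix * ∑ r ∈ Finset.range m, (X : R[X]) ^ r • (A ^ (m - 1 - r)).map C =
      (X : R[X]) ^ m • 1 - (A ^ m).map C := by
  have hmap (s : ℕ) : (A ^ s).map C = (C.mapMatrix A) ^ s := map_pow C.mapMatrix A s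
  have hscalar (s : ℕ) (M : Matrix n n R[X]) :
      (X : R[X]) ^ s • M = (scalar n (X : R[X])) ^ s * M := by
    rw [← map_pow, scalar_apply, smul_eq_diagonal_mul]
  simp only [hmap, hscalar, mul_one]
  exact (scalar_commute X (Commute.all X) (C.mapMatrix A)).mul_geom_sum₂ m

theorem sum_X_pow_mul_charpoly_mul_trace_pow (A : Matrix n n R) (m : ℕ) :
    ∑ r ∈ Finset.range m, X ^ r * A.charpoly * C (A ^ (m - 1 - r)).trace =
      X ^ m * derivative A.charpoly - (A.charmatrix.adjugate * (A ^ m).map C).trace := by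
  have htrace_map (B : Matrix n n R) : (B.map C).trace = C B.trace :=
    (AddMonoidHom.map_trace C.toAddMonoidHom B).symm
  have h := congrArg (fun M => (A.charmatrix.adjugate * M).trace) (charmatrix_mul_geom_sum A m)
  simpa only [← mul_assoc, adjugate_mul, ← charpoly.eq_1, mul_sub, mul_smul_comm, mul_one,
    smul_mul_assoc, one_mul, Finset.mul_sum, smul_smul, trace_sub, trace_sum, trace_smul,
    smul_eq_mul, htrace_map, ← derivative_charpoly_eq_trace_adjugate] using h

-- Newton's identities, by comparing the coefficients of `X ^ card n` in the preceding lemma.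
theorem sum_charpoly_coeff_mul_trace_pow (A : Matrix n n R) {m : ℕ} (hm : m ≤ Fintype.card n) :
    ∑ r ∈ Finset.range (m + 1), A.charpoly.coeff (Fintype.card n - r) * (A ^ (m - r)).trace =
      (Fintype.card n - m : ℕ) * A.charpoly.coeff (Fintype.card n - m) := by
  have hadj : (A.charmatrix.adjugate * (A ^ (m + 1)).map C).trace.coeff (Fintype.card n) = 0 := by
    simp only [trace, diag_apply, mul_apply, map_apply, finsetSum_coeff, coeff_mul_C]
    exact Finset.sum_eq_zero fun i _ => Finset.sum_eq_zero fun j _ => by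
      rw [coeff_eq_zero_of_natDegree_lt (natDegree_adjugate_charmatrix_lt A i j), zero_mul]
  have hderiv : (X ^ (m + 1) * derivative A.charpoly).coeff (Fintype.card n) =
      (Fintype.card n - m : ℕ) * A.charpoly.coeff (Fintype.card n - m) := by
    rcases hm.eq_or_lt with rfl | hm
    · rw [coeff_X_pow_mul', if_neg (by omega), Nat.sub_self, Nat.cast_zero, zero_mul]
    · obtain ⟨s, hs⟩ := Nat.exists_eq_add_of_lt hm
      rw [hs, show m + s + 1 = s + (m + 1) by omega, coeff_X_pow_mul, coeff_derivative,
        show s + (m + 1) - m = s + 1 by omega, Nat.cast_succ, mul_comm]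
  have hcoeff := congrArg (coeff · (Fintype.card n))
    (sum_X_pow_mul_charpoly_mul_trace_pow A (m + 1))
  simp only [finsetSum_coeff, coeff_sub, hadj, hderiv, sub_zero, coeff_mul_C] at hcoeff
  rw [← hcoeff]
  refine Finset.sum_congr rfl fun r hr => ?_
  rw [Finset.mem_range] at hr
  rw [coeff_X_pow_mul', if_pos (by omega), Nat.add_sub_cancel]

theorem trace_pow_eq_neg_mul_charpoly_coeff_sub_sum (A : Matrix n n R) {m : ℕ} (hm₀ : 0 < m)
    (hm : m ≤ Fintype.card n) :
    (A ^ m).trace = -(m * A.charpoly.coeff (Fintype.card n - m)) -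
      ∑ r ∈ Finset.Ico 1 m, A.charpoly.coeff (Fintype.card n - r) * (A ^ (m - r)).trace := by
  have hlead : A.charpoly.coeff (Fintype.card n) = 1 := by
    nontriviality R
    simpa only [leadingCoeff, charpoly_natDegree_eq_dim] using (charpoly_monic A).leadingCoeff
  have h := sum_charpoly_coeff_mul_trace_pow A hm
  rw [Finset.sum_range_succ, Finset.range_eq_Ico, Finset.sum_eq_sum_Ico_succ_bot hm₀] at h
  simp only [Nat.sub_zero, hlead, Nat.sub_self, pow_zero, trace_one, one_mul, zero_add,
    Nat.cast_sub hm] at h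
  linear_combination h

section Lacunary

variable {A : Matrix n n R} {p : ℕ}

theorem trace_pow_eq_neg_mul_charpoly_coeff_of_lt_two_mul
    (hA : ∀ r, 0 < r → r < p → A.charpoly.coeff (Fintype.card n - r) = 0) {m : ℕ} (hm₀ : 0 < m)
    (hm : m ≤ Fintype.card n) (hmp : m < 2 * p) :
    (A ^ m).trace = -(m * A.charpoly.coeff (Fintype.card n - m)) := by
  induction m using Nat.strong_induction_on with
  | _ m ih =>
    rw [trace_pow_eq_neg_mul_charpoly_coeff_sub_sum A hm₀ hm, sub_eq_self]
    refine Finset.sum_eq_zero fun r hr => ?_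
    rw [Finset.mem_Ico] at hr
    rcases lt_or_ge r p with hrp | hpr
    · rw [hA r hr.1 hrp, zero_mul]
    · rw [ih (m - r) (by omega) (by omega) (by omega) (by omega),
        hA (m - r) (by omega) (by omega), mul_zero, neg_zero, mul_zero]

theorem trace_pow_two_mul_eq_of_charpoly_coeff_eq_zero (hp : 0 < p)
    (hA : ∀ r, 0 < r → r < p → A.charpoly.coeff (Fintype.card n - r) = 0)
    (hpn : 2 * p ≤ Fintype.card n) :
    (A ^ (2 * p)).trace = p * A.charpoly.coeff (Fintype.card n - p) ^ 2 -
      2 * p * A.charpoly.coeff (Fintype.card n - 2 * p) := by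
  rw [trace_pow_eq_neg_mul_charpoly_coeff_sub_sum A (by omega) hpn,
    Finset.sum_eq_single_of_mem p (Finset.mem_Ico.2 (by omega)), show 2 * p - p = p by omega,
    trace_pow_eq_neg_mul_charpoly_coeff_of_lt_two_mul hA hp (by omega) (by omega)]
  · push_cast
    ring
  · intro r hr hrp
    rw [Finset.mem_Ico] at hr
    rcases hrp.lt_or_gt with hrp | hpr
    · rw [hA r hr.1 hrp, zero_mul]
    · rw [trace_pow_eq_neg_mul_charpoly_coeff_of_lt_two_mul hA (by omega) (by omega) (by omega),
        hA (2 * p - r) (by omega) (by omega), mul_zero, neg_zero, mul_zero]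

end Lacunary

end NewtonIdentities

section NonnegativeMatrices

open Matrix

variable {n R : Type*}

theorem isIrreducible_of_transGen [Ring R] [LinearOrder R] {A : Matrix n n R}
    (hA : ∀ i j, 0 ≤ A i j) (h : ∀ i j, Relation.TransGen (fun i j => 0 < A i j) i j) :
    A.IsIrreducible := by
  refine ⟨hA, fun i j => ?_⟩
  let := toQuiver A
  induction h i j with
  | single e => exact ⟨Quiver.Hom.toPath (PLift.up e), Nat.one_pos⟩
  | tail _ e ih =>
    obtain ⟨q, -⟩ := ih
    exact ⟨q.cons (PLift.up e), Nat.succ_pos _⟩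

variable [Fintype n]

theorem mul_apply_nonneg [Semiring R] [PartialOrder R] [IsOrderedRing R] {A B : Matrix n n R}
    (hA : ∀ i j, 0 ≤ A i j) (hB : ∀ i j, 0 ≤ B i j) (i j : n) : 0 ≤ (A * B) i j := by
  rw [mul_apply]
  exact Finset.sum_nonneg fun l _ => mul_nonneg (hA i l) (hB l j)

theorem mul_apply_pos [Semiring R] [PartialOrder R] [IsStrictOrderedRing R] {A B : Matrix n n R}
    (hA : ∀ i j, 0 ≤ A i j) (hB : ∀ i j, 0 ≤ B i j) {i j l : n} (hij : 0 < A i j)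
    (hjl : 0 < B j l) : 0 < (A * B) i l := by
  rw [mul_apply]
  exact Finset.sum_pos' (fun r _ => mul_nonneg (hA i r) (hB r l))
    ⟨j, Finset.mem_univ j, mul_pos hij hjl⟩

theorem sum_sq_diag_le_trace_mul_self [Semiring R] [PartialOrder R] [IsOrderedRing R]
    {B : Matrix n n R} (hB : ∀ i j, 0 ≤ B i j) : ∑ i, B i i ^ 2 ≤ (B * B).trace := by
  refine Finset.sum_le_sum fun i _ => ?_
  rw [diag_apply, mul_apply, sq]
  exact Finset.single_le_sum (f := fun j => B i j * B j i)
    (fun j _ => mul_nonneg (hB i j) (hB j i)) (Finset.mem_univ i)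

variable [CommRing R] [LinearOrder R] [IsStrictOrderedRing R]

theorem sum_sq_diag_sub_le {B : Matrix n n R} (hB : ∀ i j, 0 ≤ B i j) (a : R) :
    ∑ i, (B i i - a) ^ 2 ≤ (B * B).trace - 2 * a * B.trace + Fintype.card n * a ^ 2 := by
  have hexpand : ∑ i, (B i i - a) ^ 2 =
      ∑ i, B i i ^ 2 - 2 * a * B.trace + Fintype.card n * a ^ 2 := by
    simp only [sub_sq, mul_right_comm _ _ a, Finset.sum_add_distrib, Finset.sum_sub_distrib,
      ← Finset.mul_sum, trace, diag_apply, Finset.sum_const, Finset.card_univ, nsmul_eq_mul]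
  rw [hexpand]
  gcongr
  exact sum_sq_diag_le_trace_mul_self hB

theorem eq_of_apply_pos_of_mul_eq_smul_one [DecidableEq n] {B B' : Matrix n n R}
    (hB : ∀ i j, 0 ≤ B i j) (hB' : ∀ i j, 0 ≤ B' i j) {a : R} (ha : a ≠ 0)
    (h : B * B' = a • (1 : Matrix n n R)) (h' : B' * B = a • (1 : Matrix n n R)) {i j j' : n}
    (hij : 0 < B i j) (hij' : 0 < B i j') : j = j' := by
  have hdiag {C : Matrix n n R} (hC : C = a • 1) {x y : n} (hxy : 0 < C x y) : x = y := by
    by_contra hne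
    rw [hC, Matrix.smul_apply, one_apply_ne hne, smul_zero] at hxy
    exact hxy.false
  obtain ⟨l, hjl⟩ : ∃ l, 0 < B' j l := by
    have hjj : (B' * B) j j ≠ 0 := by
      rwa [h', Matrix.smul_apply, one_apply_eq, smul_eq_mul, mul_one]
    rw [mul_apply] at hjj
    obtain ⟨l, -, hl⟩ := Finset.exists_ne_zero_of_sum_ne_zero hjj
    exact ⟨l, (hB' j l).lt_of_ne' (left_ne_zero_of_mul hl)⟩
  obtain rfl : i = l := hdiag h (mul_apply_pos hB hB' hij hjl)
  exact hdiag h' (mul_apply_pos hB' hB hjl hij')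

variable {A : Matrix n n R}

theorem eq_zero_of_commute_of_mul_self_eq_zero {B : Matrix n n R} (hA : A.IsIrreducible)
    (hB : ∀ i j, 0 ≤ B i j) (hcomm : Commute B A) (hsq : B * B = 0) : B = 0 := by
  classical
  by_contra hne
  obtain ⟨i, j, hij⟩ : ∃ i j, 0 < B i j := by
    by_contra! h
    exact hne (ext fun i j => (h i j).antisymm (hB i j))
  obtain ⟨r, -, hr⟩ := (isIrreducible_iff_exists_pow_pos hA.nonneg).1 hA j i
  have hAr := pow_apply_nonneg hA.nonneg r
  have hpos : 0 < (B * A ^ r * B) i j :=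
    mul_apply_pos (mul_apply_nonneg hB hAr) hB (mul_apply_pos hB hAr hij hr) hij
  rw [(hcomm.pow_right r).eq, mul_assoc, hsq, mul_zero] at hpos
  exact hpos.false

variable [DecidableEq n]

theorem exists_pow_apply_pos_of_pow_eq_smul_one (hA : A.IsIrreducible) {p : ℕ} (hp : 0 < p) {a : R}
    (h : A ^ p = a • (1 : Matrix n n R)) (i j : n) : ∃ r : Fin p, 0 < (A ^ (r : ℕ)) i j := by
  obtain ⟨s, -, hs⟩ := (isIrreducible_iff_exists_pow_pos hA.nonneg).1 hA i j
  refine ⟨⟨s % p, Nat.mod_lt _ hp⟩, (pow_apply_nonneg hA.nonneg _ i j).lt_of_ne' ?_⟩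
  rw [← Nat.mod_add_div s p, pow_add, pow_mul, h, _root_.smul_pow, one_pow, mul_smul_comm, mul_one,
    Matrix.smul_apply, smul_eq_mul] at hs
  exact right_ne_zero_of_mul hs.ne'

theorem card_le_of_isIrreducible_of_pow_eq_smul_one (hA : A.IsIrreducible) {p : ℕ} (hp : 0 < p)
    {a : R} (ha : a ≠ 0) (h : A ^ p = a • (1 : Matrix n n R)) : Fintype.card n ≤ p := by
  rcases isEmpty_or_nonempty n with hn | ⟨⟨i⟩⟩
  · simp
  choose r hr using exists_pow_apply_pos_of_pow_eq_smul_one hA hp h i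
  have hinj : Function.Injective r := fun j j' hjj' =>
    eq_of_apply_pos_of_mul_eq_smul_one (pow_apply_nonneg hA.nonneg (r j))
      (pow_apply_nonneg hA.nonneg (p - r j)) ha
      (by rwa [← pow_add, Nat.add_sub_cancel' (r j).2.le])
      (by rwa [← pow_add, Nat.sub_add_cancel (r j).2.le]) (hr j) (hjj' ▸ hr j')
  simpa using Fintype.card_le_of_injective r hinj

end NonnegativeMatrices

section MonicOfCoeffs

variable {R : Type*} [CommRing R]

/-- The monic polynomial `x ^ n + a 1 * x ^ (n - 1) + ⋯ + a n`, truncating one coefficient sequence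
at every degree; the value `a 0` does not matter. -/
noncomputable def monicOfCoeffs (a : ℕ → R) (n : ℕ) : R[X] :=
  X ^ n + ∑ i ∈ Finset.Icc 1 n, C (a i) * X ^ (n - i)

theorem monicOfCoeffs_zero (a : ℕ → R) : monicOfCoeffs a 0 = 1 := by
  simp [monicOfCoeffs]

theorem monicOfCoeffs_succ (a : ℕ → R) (n : ℕ) :
    monicOfCoeffs a (n + 1) = X * monicOfCoeffs a n + C (a (n + 1)) := by
  have hsum : ∑ i ∈ Finset.Icc 1 n, C (a i) * X ^ (n + 1 - i) =
      X * ∑ i ∈ Finset.Icc 1 n, C (a i) * X ^ (n - i) := by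
    rw [Finset.mul_sum]
    refine Finset.sum_congr rfl fun i hi => ?_
    rw [Nat.sub_add_comm (Finset.mem_Icc.1 hi).2]
    ring
  rw [monicOfCoeffs, Finset.sum_Icc_succ_top (by omega), hsum, Nat.sub_self, monicOfCoeffs]
  ring

theorem coeff_monicOfCoeffs (a : ℕ → R) {n r : ℕ} (hr : 0 < r) (hrn : r ≤ n) :
    (monicOfCoeffs a n).coeff (n - r) = a r := by
  rw [monicOfCoeffs, coeff_add, coeff_X_pow, if_neg (by omega), zero_add, finsetSum_coeff,
    Finset.sum_eq_single_of_mem r (Finset.mem_Icc.2 ⟨hr, hrn⟩)]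
  · simp
  · intro i hi hir
    rw [Finset.mem_Icc] at hi
    rw [coeff_C_mul_X_pow, if_neg (by omega)]

theorem monicOfCoeffs_eq_X_pow {a : ℕ → R} {n : ℕ} (ha : ∀ i, 0 < i → i ≤ n → a i = 0) :
    monicOfCoeffs a n = X ^ n := by
  rw [monicOfCoeffs, Finset.sum_eq_zero, add_zero]
  intro i hi
  rw [Finset.mem_Icc] at hi
  rw [ha i hi.1 hi.2, C_0, zero_mul]

theorem monicOfCoeffs_add_single (a : ℕ → R) (e : R) {l n : ℕ} (hl : 0 < l) (hln : l ≤ n) :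
    monicOfCoeffs (a + Pi.single l e) n = monicOfCoeffs a n + C e * X ^ (n - l) := by
  have hsum : ∑ i ∈ Finset.Icc 1 n, C ((Pi.single l e : ℕ → R) i) * X ^ (n - i) =
      C e * X ^ (n - l) := by
    rw [Finset.sum_eq_single_of_mem l (Finset.mem_Icc.2 ⟨hl, hln⟩)]
    · rw [Pi.single_eq_same]
    · intro i _ hi
      rw [Pi.single_eq_of_ne hi, C_0, zero_mul]
  simp only [monicOfCoeffs, Pi.add_apply, C_add, add_mul, Finset.sum_add_distrib, hsum, add_assoc]

end MonicOfCoeffs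

section LoopedPath

open Matrix

section Charpoly

variable {R : Type*} [CommRing R] {N : ℕ}

theorem det_mul_apply_zero_of_hessenberg {M : Matrix (Fin (N + 1)) (Fin (N + 1)) R}
    {v : Fin (N + 1) → R} {w : R}
    (hM : ∀ (i : Fin N) (j : Fin (N + 1)), i.succ < j → M i.castSucc j = 0)
    (hv : M *ᵥ v = Pi.single (Fin.last N) w) :
    M.det * v 0 = (∏ i : Fin N, -M i.castSucc i.succ) * w := by
  have hcramer : (M.updateCol 0 (M *ᵥ v)).det = M.det * v 0 := by
    rw [← cramer_apply, cramer_eq_adjugate_mulVec, mulVec_mulVec, adjugate_mul, smul_mulVec,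
      one_mulVec, Pi.smul_apply, smul_eq_mul]
  have hminor : ((M.updateCol 0 (Pi.single (Fin.last N) w)).submatrix (Fin.last N).succAbove
      Fin.succ).det = ∏ i : Fin N, M i.castSucc i.succ := by
    rw [det_of_isLowerTriangular]
    · simp [updateCol_ne]
    · intro i j hij
      simpa [updateCol_ne] using hM i j.succ (Fin.succ_lt_succ_iff.2 hij)
  rw [← hcramer, hv, det_succ_column_zero, Finset.sum_eq_single (Fin.last N), hminor,
    updateCol_self, Pi.single_eq_same, Fin.val_last, Finset.prod_neg, Finset.card_univ,
    Fintype.card_fin, mul_right_comm]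
  · intro i _ hi
    rw [updateCol_self, Pi.single_eq_of_ne hi, mul_zero, zero_mul]
  · exact fun h => absurd (Finset.mem_univ _) h

theorem charmatrix_mulVec_apply {n : Type*} [Fintype n] [DecidableEq n] (A : Matrix n n R)
    (v : n → R[X]) (i : n) : (A.charmatrix *ᵥ v) i = X * v i - ∑ j, C (A i j) * v j := by
  rw [charmatrix, sub_mulVec, Pi.sub_apply, scalar_apply, mulVec_diagonal]
  rfl

theorem sum_C_single_mul {n : Type*} [Fintype n] [DecidableEq n] (i : n) (r : R) (v : n → R[X]) :
    ∑ j, C ((Pi.single i r : n → R) j) * v j = C r * v i := by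
  rw [Finset.sum_eq_single_of_mem i (Finset.mem_univ i) fun j _ hj => by
    rw [Pi.single_eq_of_ne hj, C_0, zero_mul], Pi.single_eq_same]

/-- The adjacency matrix of the weighted digraph on `0, …, N` with the path `0 → 1 → ⋯ → N` of
weight one, edges `i → 0` of weight `-a (i + 1)` and one more edge `N → m` of weight `d`, parallel
edges adding up. Without the last edge this is the companion matrix of `monicOfCoeffs a (N + 1)`. -/
def loopedPathMatrix (a : ℕ → R) (d : R) (m : Fin (N + 1)) :
    Matrix (Fin (N + 1)) (Fin (N + 1)) R :=
  of (Fin.snoc (fun i => Pi.single i.succ 1 + Pi.single 0 (-a (i + 1)))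
    (Pi.single m d + Pi.single 0 (-a (N + 1))))

variable (a : ℕ → R) (d : R) (m : Fin (N + 1))

theorem loopedPathMatrix_castSucc (i : Fin N) :
    loopedPathMatrix a d m i.castSucc = Pi.single i.succ 1 + Pi.single 0 (-a (i + 1)) := by
  ext1 j
  rw [loopedPathMatrix, of_apply, Fin.snoc_castSucc]

theorem loopedPathMatrix_last :
    loopedPathMatrix a d m (Fin.last N) = Pi.single m d + Pi.single 0 (-a (N + 1)) := by
  ext1 j
  rw [loopedPathMatrix, of_apply, Fin.snoc_last]

theorem charmatrix_loopedPathMatrix_mulVec :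
    (loopedPathMatrix a d m).charmatrix *ᵥ (fun i => monicOfCoeffs a i) =
      Pi.single (Fin.last N) (monicOfCoeffs a (N + 1) - C d * monicOfCoeffs a m) := by
  ext1 i
  rw [charmatrix_mulVec_apply]
  induction i using Fin.lastCases with
  | last =>
    simp only [loopedPathMatrix_last, Pi.add_apply, C_add, add_mul, Finset.sum_add_distrib,
      sum_C_single_mul, Fin.val_last, Fin.val_zero, monicOfCoeffs_zero, monicOfCoeffs_succ,
      Pi.single_eq_same, C_neg]
    ring
  | cast i =>
    simp only [loopedPathMatrix_castSucc, Pi.add_apply, C_add, add_mul, Finset.sum_add_distrib,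
      sum_C_single_mul, Fin.val_castSucc, Fin.val_succ, Fin.val_zero, monicOfCoeffs_zero,
      monicOfCoeffs_succ, Pi.single_eq_of_ne (Fin.castSucc_ne_last i), C_neg, C_1]
    ring

theorem charpoly_loopedPathMatrix : (loopedPathMatrix a d m).charpoly =
    monicOfCoeffs a (N + 1) - C d * monicOfCoeffs a m := by
  have hsuper (i : Fin N) : (loopedPathMatrix a d m).charmatrix i.castSucc i.succ = -1 := by
    rw [charmatrix_apply_ne _ _ _ Fin.castSucc_lt_succ.ne, loopedPathMatrix_castSucc, Pi.add_apply,
      Pi.single_eq_same, Pi.single_eq_of_ne (Fin.succ_ne_zero i), add_zero, C_1]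
  have hzero (i : Fin N) (j : Fin (N + 1)) (hij : i.succ < j) :
      (loopedPathMatrix a d m).charmatrix i.castSucc j = 0 := by
    rw [charmatrix_apply_ne _ _ _ (Fin.castSucc_lt_succ.trans hij).ne, loopedPathMatrix_castSucc,
      Pi.add_apply, Pi.single_eq_of_ne hij.ne', Pi.single_eq_of_ne ((Fin.succ_pos i).trans hij).ne',
      add_zero, C_0, neg_zero]
  rw [charpoly]
  simpa only [hsuper, neg_neg, Finset.prod_const_one, Fin.val_zero, monicOfCoeffs_zero, mul_one,
    one_mul] using
    det_mul_apply_zero_of_hessenberg hzero (charmatrix_loopedPathMatrix_mulVec a d m)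

end Charpoly

section Irreducible

theorem single_apply_nonneg {ι R : Type*} [DecidableEq ι] [Zero R] [Preorder R] {i : ι} {r : R}
    (hr : 0 ≤ r) (j : ι) : 0 ≤ (Pi.single i r : ι → R) j :=
  have h : (0 : ι → R) ≤ Pi.single i r := Pi.single_nonneg.2 hr
  h j

variable {R : Type*} [CommRing R] [LinearOrder R] [IsStrictOrderedRing R] {N : ℕ} {a : ℕ → R}
  {d : R} {m : Fin (N + 1)}

theorem loopedPathMatrix_nonneg (ha : ∀ i, 0 < i → i ≤ N + 1 → a i ≤ 0) (hd : 0 ≤ d)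
    (i j : Fin (N + 1)) : 0 ≤ loopedPathMatrix a d m i j := by
  have hback {l : ℕ} (hl : l ≤ N) : 0 ≤ (Pi.single 0 (-a (l + 1)) : Fin (N + 1) → R) j :=
    single_apply_nonneg (neg_nonneg.2 (ha _ l.succ_pos (by omega))) j
  induction i using Fin.lastCases with
  | last =>
    rw [loopedPathMatrix_last, Pi.add_apply]
    exact add_nonneg (single_apply_nonneg hd j) (hback le_rfl)
  | cast i =>
    rw [loopedPathMatrix_castSucc, Pi.add_apply]
    exact add_nonneg (single_apply_nonneg zero_le_one j) (hback i.2.le)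

theorem loopedPathMatrix_castSucc_succ_pos (i : Fin N) :
    0 < loopedPathMatrix a d m i.castSucc i.succ := by
  rw [loopedPathMatrix_castSucc, Pi.add_apply, Pi.single_eq_same,
    Pi.single_eq_of_ne (Fin.succ_ne_zero i), add_zero]
  exact one_pos

theorem loopedPathMatrix_last_pos (ha : ∀ i, 0 < i → i ≤ N + 1 → a i ≤ 0) (hd : 0 < d) :
    0 < loopedPathMatrix a d m (Fin.last N) m := by
  rw [loopedPathMatrix_last, Pi.add_apply, Pi.single_eq_same]
  exact add_pos_of_pos_of_nonneg hd
    (single_apply_nonneg (neg_nonneg.2 (ha _ N.succ_pos le_rfl)) m)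

theorem loopedPathMatrix_zero_pos (hd : 0 ≤ d) {i : Fin (N + 1)} (hi : a (i + 1) < 0) :
    0 < loopedPathMatrix a d m i 0 := by
  induction i using Fin.lastCases with
  | last =>
    rw [loopedPathMatrix_last, Pi.add_apply, Pi.single_eq_same]
    exact add_pos_of_nonneg_of_pos (single_apply_nonneg hd 0) (neg_pos.2 hi)
  | cast i =>
    rw [loopedPathMatrix_castSucc, Pi.add_apply, Pi.single_eq_same]
    exact add_pos_of_nonneg_of_pos (single_apply_nonneg zero_le_one 0) (neg_pos.2 hi)

theorem loopedPathMatrix_isIrreducible (ha : ∀ i, 0 < i → i ≤ N + 1 → a i ≤ 0) (hd : 0 < d)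
    {i : Fin (N + 1)} (hmi : m ≤ i) (hi : a (i + 1) < 0) :
    (loopedPathMatrix a d m).IsIrreducible := by
  refine isIrreducible_of_transGen (loopedPathMatrix_nonneg ha hd.le) fun x y => ?_
  have hup {x y : Fin (N + 1)} (hxy : x ≤ y) :
      Relation.ReflTransGen (fun x y => 0 < loopedPathMatrix a d m x y) x y := by
    refine reflTransGen_of_succ_of_le _ (fun z hz => ?_) hxy
    obtain ⟨z, rfl⟩ := Fin.exists_castSucc_eq.2 (hz.2.trans_le (Fin.le_last y)).ne
    rw [Fin.orderSucc_castSucc]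
    exact loopedPathMatrix_castSucc_succ_pos z
  calc Relation.TransGen _ x i :=
      ((Relation.TransGen.tail' (hup (Fin.le_last x)) (loopedPathMatrix_last_pos ha hd)).trans_left
        (hup hmi))
    Relation.TransGen _ i y :=
      Relation.TransGen.head' (loopedPathMatrix_zero_pos hd.le hi) (hup (Fin.zero_le y))

end Irreducible

end LoopedPath

section Realization

theorem IsIrreduciblyRealizable.isRealizable {n : ℕ} {P : ℝ[X]}
    (h : IsIrreduciblyRealizable n P) : IsRealizable n P :=
  let ⟨A, hA, hP⟩ := h
  ⟨A, hA.nonneg, hP⟩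

section LoopedPath

variable {a : ℕ → ℝ} {d : ℝ} {m n : ℕ}

theorem isRealizable_monicOfCoeffs_sub (ha : ∀ i, 0 < i → i ≤ n → a i ≤ 0) (hd : 0 ≤ d)
    (hm : m < n) : IsRealizable n (monicOfCoeffs a n - C d * monicOfCoeffs a m) := by
  obtain ⟨N, rfl⟩ := Nat.exists_eq_add_one_of_ne_zero (Nat.ne_zero_of_lt hm)
  exact ⟨_, loopedPathMatrix_nonneg ha hd, charpoly_loopedPathMatrix a d ⟨m, hm⟩⟩

theorem isIrreduciblyRealizable_monicOfCoeffs_sub (ha : ∀ i, 0 < i → i ≤ n → a i ≤ 0) (hd : 0 < d)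
    {l : ℕ} (hml : m < l) (hl : l ≤ n) (hal : a l < 0) :
    IsIrreduciblyRealizable n (monicOfCoeffs a n - C d * monicOfCoeffs a m) := by
  obtain ⟨i, rfl⟩ := Nat.exists_eq_add_one_of_ne_zero (Nat.ne_zero_of_lt hml)
  obtain ⟨N, rfl⟩ := Nat.exists_eq_add_one_of_ne_zero (Nat.ne_zero_of_lt hl)
  exact ⟨_, loopedPathMatrix_isIrreducible (i := ⟨i, hl⟩) ha hd (Nat.le_of_lt_succ hml) hal,
    charpoly_loopedPathMatrix a d ⟨m, hml.trans_le hl⟩⟩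

end LoopedPath

section LongCycle

theorem monicOfCoeffs_eq_sub_of_long_cycle {R : Type*} [CommRing R] {a : ℕ → R} {l n : ℕ}
    (hln : l ≤ n) (hnl : n < 2 * l) (ha : ∀ i, 0 < i → i ≤ n - l → a i = 0) (d : R) :
    monicOfCoeffs a n = monicOfCoeffs (a + Pi.single l d) n -
      C d * monicOfCoeffs (a + Pi.single l d) (n - l) := by
  have hshort : monicOfCoeffs (a + Pi.single l d) (n - l) = X ^ (n - l) :=
    monicOfCoeffs_eq_X_pow fun i hi hin => by
      rw [Pi.add_apply, ha i hi hin, Pi.single_eq_of_ne (by omega), add_zero]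
  rw [monicOfCoeffs_add_single a d (by omega) hln, hshort, add_sub_cancel_right]

theorem isIrreduciblyRealizable_monicOfCoeffs_of_long_cycle {a : ℕ → ℝ} {l n : ℕ} (hln : l ≤ n)
    (hnl : n < 2 * l) (ha₀ : ∀ i, 0 < i → i ≤ n - l → a i = 0)
    (ha : ∀ i, 0 < i → i ≤ n → a i ≤ 0) (hal : a l < 0) :
    IsIrreduciblyRealizable n (monicOfCoeffs a n) := by
  rw [monicOfCoeffs_eq_sub_of_long_cycle hln hnl ha₀ (-a l / 2)]
  refine isIrreduciblyRealizable_monicOfCoeffs_sub (fun i hi hin => ?_) (by linarith)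
    (by omega : n - l < l) hln ?_
  · rw [Pi.add_apply]
    rcases eq_or_ne i l with rfl | hil
    · rw [Pi.single_eq_same]
      linarith
    · rw [Pi.single_eq_of_ne hil, add_zero]
      exact ha i hi hin
  · rw [Pi.add_apply, Pi.single_eq_same]
    linarith

end LongCycle

section TwoCycles

section Coeffs

variable {R : Type*} [CommRing R] (a : ℕ → R) {p : ℕ} (d : R)

/-- The coefficients left to the edges into `0` of a looped path on `2 * p` vertices, with
coefficients `a` in total, when an edge of weight `d` closes its second half to a cycle. This cycle
contributes `-d` to the coefficient with index `p`; its product with the disjoint cycle of length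
`p` through `0`, of weight `-(a p + d)`, contributes `-d * (a p + d)` to the one with index
`2 * p`. -/
def twoCycleCoeffs (p : ℕ) : ℕ → R :=
  a + Pi.single p d + Pi.single (2 * p) (d * (a p + d))

theorem twoCycleCoeffs_of_ne {i : ℕ} (hip : i ≠ p) (hi : i ≠ 2 * p) :
    twoCycleCoeffs a d p i = a i := by
  simp only [twoCycleCoeffs, Pi.add_apply, Pi.single_eq_of_ne hip, Pi.single_eq_of_ne hi, add_zero]

theorem twoCycleCoeffs_self (hp : 0 < p) : twoCycleCoeffs a d p p = a p + d := by
  simp only [twoCycleCoeffs, Pi.add_apply, Pi.single_eq_same,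
    Pi.single_eq_of_ne (show p ≠ 2 * p by omega), add_zero]

theorem twoCycleCoeffs_two_mul (hp : 0 < p) :
    twoCycleCoeffs a d p (2 * p) = a (2 * p) + d * (a p + d) := by
  simp only [twoCycleCoeffs, Pi.add_apply, Pi.single_eq_same,
    Pi.single_eq_of_ne (show 2 * p ≠ p by omega), add_zero]

variable {a}

theorem monicOfCoeffs_twoCycleCoeffs_self (hp : 0 < p) (ha : ∀ i, 0 < i → i < p → a i = 0) :
    monicOfCoeffs (twoCycleCoeffs a d p) p = X ^ p + C (a p + d) := by
  obtain ⟨q, rfl⟩ := Nat.exists_eq_add_one_of_ne_zero hp.ne'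
  have hshort : monicOfCoeffs (twoCycleCoeffs a d (q + 1)) q = X ^ q :=
    monicOfCoeffs_eq_X_pow fun i hi hiq => by
      rw [twoCycleCoeffs_of_ne a d (by omega) (by omega), ha i hi (by omega)]
  rw [monicOfCoeffs_succ, hshort, twoCycleCoeffs_self a d hp, pow_succ']

theorem monicOfCoeffs_eq_sub_of_two_cycles (hp : 0 < p) (ha : ∀ i, 0 < i → i < p → a i = 0) :
    monicOfCoeffs a (2 * p) = monicOfCoeffs (twoCycleCoeffs a d p) (2 * p) -
      C d * monicOfCoeffs (twoCycleCoeffs a d p) p := by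
  rw [monicOfCoeffs_twoCycleCoeffs_self d hp ha, twoCycleCoeffs,
    monicOfCoeffs_add_single _ _ (by omega) le_rfl, monicOfCoeffs_add_single _ _ hp (by omega),
    show 2 * p - p = p by omega, Nat.sub_self, pow_zero, C_mul]
  ring

end Coeffs

variable {a : ℕ → ℝ} {p : ℕ}

theorem twoCycleCoeffs_nonpos (ha₀ : ∀ i, 0 < i → i < p → a i = 0)
    (ha : ∀ i, p ≤ i → i < 2 * p → a i ≤ 0) (h2p : a (2 * p) ≤ a p ^ 2 / 4) {i : ℕ} (hi : 0 < i)
    (hip : i ≤ 2 * p) : twoCycleCoeffs a (-a p / 2) p i ≤ 0 := by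
  have hp : 0 < p := by omega
  rcases eq_or_ne i p with rfl | hne
  · rw [twoCycleCoeffs_self _ _ hp]
    linarith [ha i le_rfl (by omega)]
  rcases hip.eq_or_lt with rfl | hlt
  · rw [twoCycleCoeffs_two_mul _ _ hp]
    linarith
  rw [twoCycleCoeffs_of_ne _ _ hne hlt.ne]
  rcases hne.lt_or_gt with hip | hpi
  · exact (ha₀ i hi hip).le
  · exact ha i hpi.le hlt

theorem isRealizable_monicOfCoeffs_two_mul (hp : 0 < p) (ha₀ : ∀ i, 0 < i → i < p → a i = 0)
    (ha : ∀ i, p ≤ i → i < 2 * p → a i ≤ 0) (h2p : a (2 * p) ≤ a p ^ 2 / 4) :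
    IsRealizable (2 * p) (monicOfCoeffs a (2 * p)) := by
  rw [monicOfCoeffs_eq_sub_of_two_cycles (-a p / 2) hp ha₀]
  exact isRealizable_monicOfCoeffs_sub (fun i => twoCycleCoeffs_nonpos ha₀ ha h2p)
    (by linarith [ha p le_rfl (by omega)]) (by omega)

theorem exists_twoCycleCoeffs_neg (hp : 0 < p) (ha : ∀ i, p ≤ i → i < 2 * p → a i ≤ 0)
    (h2p : a (2 * p) ≤ a p ^ 2 / 4) (hap : a p < 0) (hex : ¬ IsExceptional p a) :
    ∃ l, p < l ∧ l ≤ 2 * p ∧ twoCycleCoeffs a (-a p / 2) p l < 0 := by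
  by_cases hmid : ∀ i, p < i → i < 2 * p → a i = 0
  · refine ⟨2 * p, by omega, le_rfl, ?_⟩
    rw [twoCycleCoeffs_two_mul _ _ hp]
    linarith [h2p.lt_of_ne fun h => hex ⟨hap, hmid, h⟩]
  · push Not at hmid
    obtain ⟨l, hpl, hl, hne⟩ := hmid
    refine ⟨l, hpl, hl.le, ?_⟩
    rw [twoCycleCoeffs_of_ne _ _ hpl.ne' hl.ne]
    exact (ha l hpl.le hl).lt_of_ne hne

theorem isIrreduciblyRealizable_monicOfCoeffs_two_mul (hp : 0 < p)
    (ha₀ : ∀ i, 0 < i → i < p → a i = 0) (ha : ∀ i, p ≤ i → i < 2 * p → a i ≤ 0)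
    (h2p : a (2 * p) ≤ a p ^ 2 / 4) (hap : a p < 0) (hex : ¬ IsExceptional p a) :
    IsIrreduciblyRealizable (2 * p) (monicOfCoeffs a (2 * p)) := by
  obtain ⟨l, hpl, hl, hneg⟩ := exists_twoCycleCoeffs_neg hp ha h2p hap hex
  rw [monicOfCoeffs_eq_sub_of_two_cycles (-a p / 2) hp ha₀]
  exact isIrreduciblyRealizable_monicOfCoeffs_sub (fun i => twoCycleCoeffs_nonpos ha₀ ha h2p)
    (by linarith) hpl hl hneg

end TwoCycles

end Realization

section EvenPoly

variable {p : ℕ} {k : ℕ → ℝ}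

theorem exists_evenPoly_eq_monicOfCoeffs (hp : 0 < p) (k : ℕ → ℝ) : ∃ a : ℕ → ℝ,
    (∀ i < p, a i = 0) ∧ (∀ i, p ≤ i → a i = k i) ∧ evenPoly p k = monicOfCoeffs a (2 * p) := by
  have hlt (i : ℕ) (hi : i < p) : (Set.Ici p).indicator k i = 0 :=
    Set.indicator_of_notMem (Set.notMem_Ici.2 hi) k
  have hge (i : ℕ) (hi : p ≤ i) : (Set.Ici p).indicator k i = k i :=
    Set.indicator_of_mem (Set.mem_Ici.2 hi) k
  refine ⟨(Set.Ici p).indicator k, hlt, hge, ?_⟩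
  rw [evenPoly, monicOfCoeffs]
  congr 1
  refine Finset.sum_subset_zero_on_sdiff (Finset.Icc_subset_Icc_left hp) (fun i hi => ?_)
    fun i hi => ?_
  · simp only [Finset.mem_sdiff, Finset.mem_Icc] at hi
    rw [hlt i (by omega), C_0, zero_mul]
  · rw [hge i (Finset.mem_Icc.1 hi).1]

theorem coeff_evenPoly (hp : 0 < p) (k : ℕ → ℝ) {r : ℕ} (hpr : p ≤ r) (hr : r ≤ 2 * p) :
    (evenPoly p k).coeff (2 * p - r) = k r := by
  obtain ⟨a, -, hak, hP⟩ := exists_evenPoly_eq_monicOfCoeffs hp k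
  rw [hP, coeff_monicOfCoeffs a (by omega) hr, hak r hpr]

theorem coeff_evenPoly_of_lt (k : ℕ → ℝ) {r : ℕ} (hr : 0 < r) (hrp : r < p) :
    (evenPoly p k).coeff (2 * p - r) = 0 := by
  obtain ⟨a, ha₀, -, hP⟩ := exists_evenPoly_eq_monicOfCoeffs (hr.trans hrp) k
  rw [hP, coeff_monicOfCoeffs a hr (by omega), ha₀ r hrp]

section Necessity

variable {A : Matrix (Fin (2 * p)) (Fin (2 * p)) ℝ}

theorem trace_pow_of_charpoly_eq_evenPoly (hA : A.charpoly = evenPoly p k) {m : ℕ} (hm₀ : 0 < m)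
    (hpm : p ≤ m) (hm : m < 2 * p) : (A ^ m).trace = -(m * k m) := by
  rw [trace_pow_eq_neg_mul_charpoly_coeff_of_lt_two_mul (p := p) _ hm₀ _ hm, hA, Fintype.card_fin,
    coeff_evenPoly (by omega) k hpm hm.le]
  · intro r hr hrp
    rw [hA, Fintype.card_fin, coeff_evenPoly_of_lt k hr hrp]
  · rw [Fintype.card_fin]
    exact hm.le

theorem trace_pow_two_mul_of_charpoly_eq_evenPoly (hp : 0 < p) (hA : A.charpoly = evenPoly p k) :
    (A ^ (2 * p)).trace = p * k p ^ 2 - 2 * p * k (2 * p) := by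
  rw [trace_pow_two_mul_eq_of_charpoly_coeff_eq_zero hp _ (Fintype.card_fin _).ge, hA,
    Fintype.card_fin, coeff_evenPoly hp k le_rfl (by omega), coeff_evenPoly hp k (by omega) le_rfl]
  intro r hr hrp
  rw [hA, Fintype.card_fin, coeff_evenPoly_of_lt k hr hrp]

theorem nonpos_of_charpoly_eq_evenPoly (hnonneg : ∀ i j, 0 ≤ A i j)
    (hA : A.charpoly = evenPoly p k) {m : ℕ} (hpm : p ≤ m) (hm : m < 2 * p) : k m ≤ 0 := by
  have hm₀ : 0 < m := by omega
  have htrace : 0 ≤ (A ^ m).trace :=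
    Finset.sum_nonneg fun i _ => Matrix.pow_apply_nonneg hnonneg m i i
  rw [trace_pow_of_charpoly_eq_evenPoly hA hm₀ hpm hm, neg_nonneg] at htrace
  exact nonpos_of_mul_nonpos_right htrace (Nat.cast_pos.2 hm₀)

theorem sum_sq_diag_pow_le_of_charpoly_eq_evenPoly (hp : 0 < p) (hnonneg : ∀ i j, 0 ≤ A i j)
    (hA : A.charpoly = evenPoly p k) :
    ∑ i, ((A ^ p) i i - -k p / 2) ^ 2 ≤ 2 * p * (k p ^ 2 / 4 - k (2 * p)) := by
  have h := sum_sq_diag_sub_le (Matrix.pow_apply_nonneg hnonneg p) (-k p / 2)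
  rw [← pow_add, ← two_mul, trace_pow_two_mul_of_charpoly_eq_evenPoly hp hA,
    trace_pow_of_charpoly_eq_evenPoly hA hp le_rfl (by omega), Fintype.card_fin] at h
  refine h.trans_eq ?_
  push_cast
  ring

theorem le_sq_div_four_of_charpoly_eq_evenPoly (hp : 0 < p) (hnonneg : ∀ i j, 0 ≤ A i j)
    (hA : A.charpoly = evenPoly p k) : k (2 * p) ≤ k p ^ 2 / 4 := by
  have h := (Finset.sum_nonneg fun i _ => sq_nonneg _).trans
    (sum_sq_diag_pow_le_of_charpoly_eq_evenPoly hp hnonneg hA)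
  exact sub_nonneg.1 (nonneg_of_mul_nonneg_right h (by positivity))

end Necessity

theorem isRealizable_evenPoly_iff (hp : 0 < p) : IsRealizable (2 * p) (evenPoly p k) ↔
    (∀ i, p ≤ i → i < 2 * p → k i ≤ 0) ∧ k (2 * p) ≤ k p ^ 2 / 4 := by
  refine ⟨fun ⟨A, hnonneg, hA⟩ => ⟨fun i hpi hi => nonpos_of_charpoly_eq_evenPoly hnonneg hA hpi hi,
    le_sq_div_four_of_charpoly_eq_evenPoly hp hnonneg hA⟩, fun ⟨hk, h2p⟩ => ?_⟩
  obtain ⟨a, ha₀, hak, hP⟩ := exists_evenPoly_eq_monicOfCoeffs hp k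
  rw [hP]
  refine isRealizable_monicOfCoeffs_two_mul hp (fun i _ => ha₀ i) (fun i hpi hi => ?_) ?_
  · rw [hak i hpi]
    exact hk i hpi hi
  · rwa [hak p le_rfl, hak (2 * p) (by omega)]

theorem exists_neg_of_evenPoly_ne_X_pow (hP : evenPoly p k ≠ X ^ (2 * p))
    (hk : ∀ i, p ≤ i → i ≤ 2 * p → k i ≤ 0) : ∃ l, p ≤ l ∧ l ≤ 2 * p ∧ k l < 0 := by
  contrapose! hP
  rw [evenPoly, Finset.sum_eq_zero, add_zero]
  intro i hi
  obtain ⟨hpi, hi⟩ := Finset.mem_Icc.1 hi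
  rw [(hk i hpi hi).antisymm (hP i hpi hi), C_0, zero_mul]

theorem isExceptional_congr {k' : ℕ → ℝ} (h : ∀ i, p ≤ i → k i = k' i) :
    IsExceptional p k ↔ IsExceptional p k' := by
  have hmid : (∀ i, p < i → i < 2 * p → k i = 0) ↔ ∀ i, p < i → i < 2 * p → k' i = 0 :=
    forall₂_congr fun i hpi => by rw [h i hpi.le]
  rw [IsExceptional, IsExceptional, h p le_rfl, h (2 * p) (by omega), hmid]

theorem isIrreduciblyRealizable_evenPoly (hP : evenPoly p k ≠ X ^ (2 * p))
    (hex : ¬ IsExceptional p k) (h : IsRealizable (2 * p) (evenPoly p k)) :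
    IsIrreduciblyRealizable (2 * p) (evenPoly p k) := by
  have hp : 0 < p := by
    rw [Nat.pos_iff_ne_zero]
    rintro rfl
    obtain ⟨A, -, hA⟩ := h
    exact hP (hA.symm.trans (Matrix.det_isEmpty (n := Fin 0)))
  obtain ⟨hk, h2p⟩ := (isRealizable_evenPoly_iff hp).1 h
  obtain ⟨a, ha₀, hak, haP⟩ := exists_evenPoly_eq_monicOfCoeffs hp k
  have ha (i : ℕ) (hpi : p ≤ i) (hi : i < 2 * p) : a i ≤ 0 := (hak i hpi).trans_le (hk i hpi hi)
  rw [← isExceptional_congr hak] at hex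
  rw [← hak p le_rfl, ← hak (2 * p) (by omega)] at h2p
  rcases (ha p le_rfl (by omega)).lt_or_eq with hap | hap
  · rw [haP]
    exact isIrreduciblyRealizable_monicOfCoeffs_two_mul hp (fun i _ => ha₀ i) ha h2p hap hex
  have hnonpos (i : ℕ) (hi : i ≤ 2 * p) : a i ≤ 0 := by
    rcases lt_or_ge i p with hip | hpi
    · exact (ha₀ i hip).le
    rcases hi.lt_or_eq with hi | rfl
    · exact ha i hpi hi
    · simpa [hap] using h2p
  obtain ⟨l, hpl, hl, hkl⟩ := exists_neg_of_evenPoly_ne_X_pow hP fun i hpi hi =>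
    (hak i hpi).symm.trans_le (hnonpos i hi)
  rw [← hak l hpl] at hkl
  have hlp : l ≠ p := by
    rintro rfl
    exact hkl.ne hap
  rw [haP]
  exact isIrreduciblyRealizable_monicOfCoeffs_of_long_cycle hl (by omega)
    (fun i _ hi => ha₀ i (by omega)) (fun i _ => hnonpos i) hkl

end EvenPoly

namespace IsExceptional

variable {p : ℕ} {k : ℕ → ℝ}

theorem pos (hk : IsExceptional p k) : 0 < p := by
  rw [Nat.pos_iff_ne_zero]
  rintro rfl
  nlinarith [hk.1, hk.2.2]

theorem evenPoly_eq (hk : IsExceptional p k) : evenPoly p k = (X ^ p + C (k p / 2)) ^ 2 := by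
  have hp := hk.pos
  obtain ⟨-, hmid, h2p⟩ := hk
  have hsum : ∑ i ∈ Finset.Icc p (2 * p), C (k i) * X ^ (2 * p - i) =
      C (k p) * X ^ p + C (k (2 * p)) := by
    rw [Finset.sum_eq_add_of_mem p (2 * p) (Finset.mem_Icc.2 (by omega))
      (Finset.mem_Icc.2 (by omega)) (by omega), show 2 * p - p = p by omega, Nat.sub_self, pow_zero,
      mul_one]
    intro i hi hne
    rw [Finset.mem_Icc] at hi
    rw [hmid i (by omega) (by omega), C_0, zero_mul]
  have hlin : (C (k p) : ℝ[X]) = 2 * C (k p / 2) := by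
    rw [← C_ofNat, ← C_mul, mul_div_cancel₀ _ two_ne_zero]
  have hconst : (C (k p ^ 2 / 4) : ℝ[X]) = C (k p / 2) ^ 2 := by
    rw [← C_pow, div_pow]
    norm_num
  rw [evenPoly, hsum, h2p, hconst, hlin]
  ring

theorem isRealizable (hk : IsExceptional p k) : IsRealizable (2 * p) (evenPoly p k) := by
  refine (isRealizable_evenPoly_iff hk.pos).2 ⟨fun i hpi hi => ?_, hk.2.2.le⟩
  rcases hpi.eq_or_lt with rfl | hpi
  · exact hk.1.le
  · exact (hk.2.1 i hpi hi).le

variable {A : Matrix (Fin (2 * p)) (Fin (2 * p)) ℝ}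

theorem pow_apply_self_eq (hk : IsExceptional p k) (hnonneg : ∀ i j, 0 ≤ A i j)
    (hA : A.charpoly = evenPoly p k) (i : Fin (2 * p)) : (A ^ p) i i = -k p / 2 := by
  have hle := sum_sq_diag_pow_le_of_charpoly_eq_evenPoly hk.pos hnonneg hA
  rw [hk.2.2, sub_self, mul_zero] at hle
  have hzero := (Finset.sum_eq_zero_iff_of_nonneg fun i _ => sq_nonneg _).1
    (hle.antisymm (Finset.sum_nonneg fun i _ => sq_nonneg _)) i (Finset.mem_univ i)
  exact sub_eq_zero.1 (sq_eq_zero_iff.1 hzero)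

theorem pow_sub_smul_one_mul_self (hk : IsExceptional p k) (hA : A.charpoly = evenPoly p k) :
    (A ^ p - (-k p / 2) • 1) * (A ^ p - (-k p / 2) • 1) = 0 := by
  have h := Matrix.aeval_self_charpoly A
  rw [hA, hk.evenPoly_eq, map_pow, map_add, map_pow, aeval_X, aeval_C,
    Algebra.algebraMap_eq_smul_one] at h
  rwa [← sq, neg_div, neg_smul, sub_neg_eq_add]

theorem pow_eq_smul_one (hk : IsExceptional p k) (hirr : A.IsIrreducible)
    (hA : A.charpoly = evenPoly p k) : A ^ p = (-k p / 2) • 1 := by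
  refine sub_eq_zero.1 (eq_zero_of_commute_of_mul_self_eq_zero hirr (fun i j => ?_)
    (((Commute.refl A).pow_left p).sub_left ((Commute.one_left A).smul_left _))
    (hk.pow_sub_smul_one_mul_self hA))
  rw [Matrix.sub_apply, Matrix.smul_apply]
  rcases eq_or_ne i j with rfl | hij
  · rw [hk.pow_apply_self_eq hirr.nonneg hA, Matrix.one_apply_eq, smul_eq_mul, mul_one, sub_self]
  · rw [Matrix.one_apply_ne hij, smul_zero, sub_zero]
    exact Matrix.pow_apply_nonneg hirr.nonneg p i j

theorem not_isIrreduciblyRealizable (hk : IsExceptional p k) :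
    ¬ IsIrreduciblyRealizable (2 * p) (evenPoly p k) := by
  rintro ⟨A, hirr, hA⟩
  have hp := hk.pos
  have hroot : 0 < -k p / 2 := by linarith [hk.1]
  have hcard := card_le_of_isIrreducible_of_pow_eq_smul_one hirr hp hroot.ne'
    (hk.pow_eq_smul_one hirr hA)
  rw [Fintype.card_fin] at hcard
  omega

end IsExceptional

theorem theorem27_general (p : ℕ) (k : ℕ → ℝ) (hP : evenPoly p k ≠ X ^ (2 * p)) :
    (¬ IsExceptional p k →
      (IsRealizable (2 * p) (evenPoly p k) ↔ IsIrreduciblyRealizable (2 * p) (evenPoly p k))) ∧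
    (IsExceptional p k →
      evenPoly p k = (X ^ p + C (k p / 2)) ^ 2 ∧
      IsRealizable (2 * p) (evenPoly p k) ∧
      ¬ IsIrreduciblyRealizable (2 * p) (evenPoly p k)) :=
  ⟨fun hex => ⟨isIrreduciblyRealizable_evenPoly hP hex, IsIrreduciblyRealizable.isRealizable⟩,
    fun hex => ⟨hex.evenPoly_eq, hex.isRealizable, hex.not_isIrreduciblyRealizable⟩⟩

theorem theorem27 (p : ℕ) (hp : 3 ≤ p) (k : ℕ → ℝ) (hP : evenPoly p k ≠ X ^ (2 * p)) :
    (¬ IsExceptional p k →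
      (IsRealizable (2 * p) (evenPoly p k) ↔ IsIrreduciblyRealizable (2 * p) (evenPoly p k))) ∧
    (IsExceptional p k →
      evenPoly p k = (X ^ p + C (k p / 2)) ^ 2 ∧
      IsRealizable (2 * p) (evenPoly p k) ∧
      ¬ IsIrreduciblyRealizable (2 * p) (evenPoly p k)) :=
  theorem27_general p k hP
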